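/- Rings are associative with $1$, ring homomorphisms preserve $1$, and "ideal" means two-sided ideal. A prime ideal of a ring $R$ is a proper ideal $\mathfrak p$ such that, for ideals $I,J$ of $R$, $IJ\subseteq\mathfrak p$ implies $I\subseteq\mathfrak p$ or $J\subseteq\mathfrak p$; $\min(R)$ is the set of prime ideals that are minimal with respect to inclusion; $R$ is semiprime if the intersection of all its prime ideals is zero. A ring embeds into another if there is an injective ring homomorphism from the first to the second. A semisimple Artinian ring is a ring that is semisimple as a module over itself, and a simple Artinian ring is an Artinian ring that has exactly two ideals. An element of $R$ is regular if it is neither a left nor a right zero divisor. A regular left Ore set of $R$ is a multiplicatively closed set $S\ni 1$ of regular elements such that $Sr\cap Rs\neq\emptyset$ for all $r\in R$, $s\in S$. Every ring $R$ has a largest regular left Ore set $S_l(R)$ with respect to inclusion, and $Q_l(R):=S_l(R)^{-1}R$ is called the largest left quotient ring of $R$. Symmetrically, $S_r(R)$ is the largest regular right Ore set of $R$ and $Q_r(R):=R\,S_r(R)^{-1}$ is the largest right quotient ring of $R$. **Theorem 1.1.** Let $R$ be a semiprime ring. The following statements are equivalent: 1. $R$ embeds into a semisimple Artinian ring. 2.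 $|\min(R)|<\infty$ and the ring $Q_l(R)$ embeds into a semisimple Artinian ring. 3. $|\min(R)|<\infty$ and, for every $\mathfrak p\in\min(R)$, the ring $Q_l(R/\mathfrak p)$ embeds into a simple Artinian ring. 4. $|\min(R)|<\infty$ and the ring $Q_r(R)$ embeds into a semisimple Artinian ring. 5. $|\min(R)|<\infty$ and, for every $\mathfrak p\in\min(R)$, the ring $Q_r(R/\mathfrak p)$ embeds into a simple Artinian ring. -/

import Mathlib

universe u v

/-! All rings are associative with `1`, not necessarily commutative; ring homomorphisms preserve
`1`. Ideals without further qualification are two-sided, and `p.ringCon.Quotient` is the factor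
ring `R/p` of `R` modulo the two-sided ideal `p`. -/

namespace SemiprimeEmbedding

section Primes

variable {R : Type u} [Ring R]

/-- A prime ideal of a noncommutative ring: a proper two-sided ideal `p` such that, for two-sided
ideals `I` and `J`, the inclusion `I J ⊆ p` implies `I ⊆ p` or `J ⊆ p`. -/
structure IsPrimeIdeal (p : TwoSidedIdeal R) : Prop where
  ne_top : p ≠ ⊤
  le_or_le : ∀ I J : TwoSidedIdeal R, (∀ a ∈ I, ∀ b ∈ J, a * b ∈ p) → I ≤ p ∨ J ≤ p

variable (R)

/-- The prime radical: the intersection of all prime ideals (the whole ring if there are none). -/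
def primeRadical : TwoSidedIdeal R := sInf {p | IsPrimeIdeal p}

/-- A ring is semiprime if its prime radical is zero. -/
def IsSemiprimeRing : Prop := primeRadical R = ⊥

/-- The set `min(R)` of minimal primes: the prime ideals that are minimal under inclusion. -/
def minPrimes : Set (TwoSidedIdeal R) := {p | Minimal IsPrimeIdeal p}

end Primes

section Ore

variable {R : Type u} [Ring R]

/-- A regular left Ore set: a multiplicative subset consisting of regular elements (that is,
of elements which are neither left nor right zero divisors) such that `Sr ∩ Rs` is nonempty for all
`r ∈ R` and `s ∈ S`. -/
structure IsRegularLeftOre (S : Submonoid R) : Prop where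
  regular : S ≤ nonZeroDivisors R
  ore : ∀ r : R, ∀ s ∈ S, ∃ s' ∈ S, ∃ r' : R, s' * r = r' * s

/-- A regular right Ore set: a multiplicative subset consisting of regular elements such that
`rS ∩ sR` is nonempty for all `r ∈ R` and `s ∈ S`. -/
structure IsRegularRightOre (S : Submonoid R) : Prop where
  regular : S ≤ nonZeroDivisors R
  ore : ∀ r : R, ∀ s ∈ S, ∃ s' ∈ S, ∃ r' : R, r * s' = s * r'

variable (R)

/-- The largest regular left Ore set `S_l(R)`, obtained as the submonoid generated by all regular
left Ore sets; see `isGreatest_largestLeftOre`. -/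
def largestLeftOre : Submonoid R := sSup {S | IsRegularLeftOre S}

theorem isRegularLeftOre_largestLeftOre : IsRegularLeftOre (largestLeftOre R) where
  regular := sSup_le fun _ hS => hS.regular
  ore := by
    intro r s hs
    have key : ∀ s ∈ Submonoid.closure (⋃ S ∈ {S : Submonoid R | IsRegularLeftOre S}, (S : Set R)),
        ∀ r : R, ∃ s' ∈ largestLeftOre R, ∃ r' : R, s' * r = r' * s := by
      intro s hs
      induction hs using Submonoid.closure_induction with
      | mem x hx =>
        intro r
        simp only [Set.mem_iUnion, SetLike.mem_coe] at hx
        obtain ⟨S, hS, hxS⟩ := hx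
        obtain ⟨s', hs', r', h⟩ := IsRegularLeftOre.ore hS r x hxS
        exact ⟨s', (le_sSup hS : S ≤ sSup {S | IsRegularLeftOre S}) hs', r', h⟩
      | one => exact fun r => ⟨1, one_mem _, r, by simp⟩
      | mul x y _ _ hx hy =>
        intro r
        obtain ⟨b, hb, r₁, h₁⟩ := hy r
        obtain ⟨a, ha, r₂, h₂⟩ := hx r₁
        exact ⟨a * b, mul_mem ha hb, r₂, by rw [mul_assoc, h₁, ← mul_assoc, h₂, mul_assoc]⟩
    refine key s ?_ r
    simpa [largestLeftOre, sSup_eq_iSup, Submonoid.closure_iUnion, Submonoid.closure_eq] using hs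

theorem isGreatest_largestLeftOre : IsGreatest {S | IsRegularLeftOre S} (largestLeftOre R) :=
  ⟨isRegularLeftOre_largestLeftOre R, fun _ hS => le_sSup hS⟩

noncomputable instance instOreSetLargestLeftOre : OreLocalization.OreSet (largestLeftOre R) :=
  Classical.choice <| OreLocalization.nonempty_oreSet_iff.mpr
    ⟨fun r₁ r₂ s h => ⟨1, by
        have hs := (isRegularLeftOre_largestLeftOre R).regular s.2
        rw [(mul_cancel_right_mem_nonZeroDivisors hs).mp h]⟩,
      fun r s => by
        obtain ⟨s', hs', r', h⟩ := (isRegularLeftOre_largestLeftOre R).ore r s s.2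
        exact ⟨r', ⟨s', hs'⟩, h⟩⟩

/-- The largest left quotient ring `Q_l(R) = S_l(R)⁻¹ R`. -/
abbrev LargestLeftQuotientRing : Type u := OreLocalization (largestLeftOre R) R

/-- The largest regular right Ore set `S_r(R)`, i.e. the largest regular left Ore set of the
opposite ring; see `isGreatest_largestRightOre`. -/
def largestRightOre : Submonoid R := (largestLeftOre Rᵐᵒᵖ).unop

theorem isGreatest_largestRightOre : IsGreatest {S | IsRegularRightOre S} (largestRightOre R) := by
  have hl := isRegularLeftOre_largestLeftOre Rᵐᵒᵖ
  refine ⟨⟨fun x hx => ?_, fun r s hs => ?_⟩, fun S hS => ?_⟩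
  · have h := hl.regular hx
    exact ⟨fun y hy => MulOpposite.op_injective (h.2 (MulOpposite.op y)
        (MulOpposite.unop_injective hy)),
      fun y hy => MulOpposite.op_injective (h.1 (MulOpposite.op y)
        (MulOpposite.unop_injective hy))⟩
  · obtain ⟨s', hs', r', h⟩ := hl.ore (MulOpposite.op r) (MulOpposite.op s) hs
    exact ⟨s'.unop, hs', r'.unop, congrArg MulOpposite.unop h⟩
  · have hop : IsRegularLeftOre S.op := by
      refine ⟨fun x hx => ?_, fun r s hs => ?_⟩
      · have h := hS.regular hx
        exact ⟨fun y hy => MulOpposite.unop_injective (h.2 y.unop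
            (MulOpposite.op_injective hy)),
          fun y hy => MulOpposite.unop_injective (h.1 y.unop
            (MulOpposite.op_injective hy))⟩
      · obtain ⟨s', hs', r', h⟩ := hS.ore r.unop s.unop hs
        exact ⟨MulOpposite.op s', hs', MulOpposite.op r', congrArg MulOpposite.op h⟩
    exact fun x hx => (isGreatest_largestLeftOre Rᵐᵒᵖ).2 hop hx

/-- The largest right quotient ring `Q_r(R) = R S_r(R)⁻¹`: right localization of `R` at `S_r(R)` is
the opposite ring of left localization of the opposite ring of `R` at the same set, viewed in the
opposite ring. -/
abbrev LargestRightQuotientRing : Type u := (LargestLeftQuotientRing Rᵐᵒᵖ)ᵐᵒᵖ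

end Ore

/-- The ring `R` embeds into a semisimple Artinian ring: there is an injective (unital) ring
homomorphism from `R` into a ring that is semisimple as a module over itself
(such a ring is automatically Artinian). -/
def EmbedsInSemisimpleArtinian (R : Type u) [Ring R] : Prop :=
  ∃ (A : Type v) (_ : Ring A) (_ : IsSemisimpleRing A) (f : R →+* A), Function.Injective f

/-- The ring `R` embeds into a simple Artinian ring. -/
def EmbedsInSimpleArtinian (R : Type u) [Ring R] : Prop :=
  ∃ (A : Type v) (_ : Ring A) (_ : IsSimpleRing A) (_ : IsArtinianRing A) (f : R →+* A),
    Function.Injective f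

end SemiprimeEmbedding

/-! Let `R` embed into a semisimple ring `A`, viewed as an `A`-`R`-bimodule. Every subquotient
bimodule `M` gives a map from `R` to the semisimple ring `(End_A M)ᵐᵒᵖ`. Two choices of `M` carry
the proof. For a regular left Ore set `S`, take `M = A s` minimal among the left ideals `A t`, `t ∈
S`: it is a bimodule on which `R` acts faithfully and `S` invertibly, so `S⁻¹R` embeds too. The
factors of a finite chain of subbimodules of `A`, each maximal in the next, have prime annihilators
whose product, suitably ordered, kills `A`. Hence every prime contains one of them, and the minimal
primes are finitely many, with quotients embedding into semisimple rings. For a prime quotient, one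
Wedderburn factor suffices. Conversely, a semiprime `R` embeds into the product of its quotients by
minimal primes. The right-hand statements follow by passing to opposite rings. -/

namespace SemiprimeEmbedding

/-! ### Primes of noncommutative rings -/

section Primes

variable {R : Type u} [Ring R]

/-- The elementwise description of prime rings. -/
def IsPrimeRing (R : Type u) [Ring R] : Prop :=
  Nontrivial R ∧ ∀ a b : R, (∀ r, a * r * b = 0) → a = 0 ∨ b = 0

theorem IsPrimeRing.mulOpposite (h : IsPrimeRing R) : IsPrimeRing Rᵐᵒᵖ := by
  obtain ⟨_, h⟩ := h
  refine ⟨inferInstance, fun a b hab => ?_⟩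
  have := h b.unop a.unop fun r => by
    simpa [mul_assoc] using congrArg MulOpposite.unop (hab (MulOpposite.op r))
  simpa [or_comm] using this

/-- Primeness is applied to `I = {x | x R b ⊆ p}`, which contains `a`, and `J = {y | I y ⊆ p}`,
which contains `b`. -/
theorem IsPrimeIdeal.mem_or_mem {p : TwoSidedIdeal R} (hp : IsPrimeIdeal p) {a b : R}
    (h : ∀ r, a * r * b ∈ p) : a ∈ p ∨ b ∈ p := by
  let I : TwoSidedIdeal R := .mk' {x | ∀ r, x * r * b ∈ p}
    (by simp [p.zero_mem])
    (fun hx hy r => by simpa [add_mul] using p.add_mem (hx r) (hy r))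
    (fun hx r => by simpa using p.neg_mem (hx r))
    (fun {x y} hy r => by simpa [mul_assoc] using p.mul_mem_left x _ (hy r))
    (fun {x y} hx r => by simpa [mul_assoc] using hx (y * r))
  let J : TwoSidedIdeal R := .mk' {y | ∀ x ∈ I, x * y ∈ p}
    (by simp [p.zero_mem])
    (fun hx hy r hr => by simpa [mul_add] using p.add_mem (hx r hr) (hy r hr))
    (fun hx r hr => by simpa using p.neg_mem (hx r hr))
    (fun {x y} hy r hr => by simpa [mul_assoc] using hy (r * x) (I.mul_mem_right _ _ hr))
    (fun {x y} hx r hr => by simpa [mul_assoc] using p.mul_mem_right _ y (hx r hr))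
  have hI : ∀ {x}, x ∈ I ↔ ∀ r, x * r * b ∈ p := by simp [I]
  have hJ : ∀ {y}, y ∈ J ↔ ∀ x ∈ I, x * y ∈ p := by simp [J]
  refine (hp.le_or_le I J fun x hx y hy => hJ.1 hy x hx).imp (fun h' => h' (hI.2 h)) fun h' => ?_
  exact h' (hJ.2 fun x hx => by simpa using hI.1 hx 1)

theorem IsPrimeIdeal.isPrimeRing_quotient {p : TwoSidedIdeal R} (hp : IsPrimeIdeal p) :
    IsPrimeRing p.ringCon.Quotient := by
  have hmem : ∀ x : R, (x : p.ringCon.Quotient) = 0 ↔ x ∈ p := fun x => by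
    rw [← RingCon.coe_zero, RingCon.eq, TwoSidedIdeal.mem_iff]
  refine ⟨?_, fun a b h => ?_⟩
  · rw [RingCon.nontrivial_quotient]
    exact fun h => hp.ne_top (TwoSidedIdeal.ringCon_injective h)
  · obtain ⟨a, rfl⟩ := p.ringCon.mk'_surjective a
    obtain ⟨b, rfl⟩ := p.ringCon.mk'_surjective b
    exact (hp.mem_or_mem fun r => (hmem _).1 (h r)).imp (hmem a).2 (hmem b).2

theorem isPrimeIdeal_sInf_of_isChain {c : Set (TwoSidedIdeal R)} (hc : IsChain (· ≤ ·) c)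
    (hne : c.Nonempty) (h : ∀ p ∈ c, IsPrimeIdeal p) : IsPrimeIdeal (sInf c) := by
  obtain ⟨q, hq⟩ := hne
  refine ⟨fun htop => (h q hq).ne_top (top_le_iff.1 (htop ▸ sInf_le hq)), fun I J hIJ => ?_⟩
  by_contra! hcon
  simp only [le_sInf_iff, not_forall] at hcon
  obtain ⟨⟨p₁, hp₁, h₁⟩, p₂, hp₂, h₂⟩ := hcon
  have key : ∀ p ∈ c, I ≤ p ∨ J ≤ p := fun p hp =>
    (h p hp).le_or_le I J fun a ha b hb => (sInf_le hp : sInf c ≤ p) (hIJ a ha b hb)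
  -- The smaller of `p₁` and `p₂` would contain neither `I` nor `J`.
  rcases hc.total hp₁ hp₂ with hle | hle
  · exact (key p₁ hp₁).elim h₁ fun h' => h₂ (h'.trans hle)
  · exact (key p₂ hp₂).elim (fun h' => h₁ (h'.trans hle)) h₂

theorem IsPrimeIdeal.exists_minPrimes_le {p : TwoSidedIdeal R} (hp : IsPrimeIdeal p) :
    ∃ q ∈ minPrimes R, q ≤ p := by
  obtain ⟨m, hpm, hm⟩ := zorn_le_nonempty₀ (α := (TwoSidedIdeal R)ᵒᵈ)
    {q | IsPrimeIdeal (OrderDual.ofDual q)}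
    (fun c hcs hc y hy => ⟨OrderDual.toDual (sInf (OrderDual.toDual ⁻¹' c)),
      isPrimeIdeal_sInf_of_isChain (c := OrderDual.toDual ⁻¹' c) (fun a ha b hb hab =>
        (hc ha hb hab).symm) ⟨_, hy⟩ hcs, fun z hz => sInf_le (α := TwoSidedIdeal R) hz⟩)
    (OrderDual.toDual p) hp
  exact ⟨OrderDual.ofDual m, ⟨hm.1, fun q hq hle => hm.2 (y := OrderDual.toDual q) hq hle⟩, hpm⟩

theorem IsSemiprimeRing.eq_zero (hR : IsSemiprimeRing R) {x : R}
    (hx : ∀ p ∈ minPrimes R, x ∈ p) : x = 0 := by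
  have h : x ∈ primeRadical R := by
    rw [primeRadical, TwoSidedIdeal.mem_sInf]
    intro p hp
    obtain ⟨q, hq, hqp⟩ := IsPrimeIdeal.exists_minPrimes_le hp
    exact hqp (hx q hq)
  rw [hR] at h
  exact (TwoSidedIdeal.mem_bot R).1 h

end Primes

/-! ### Endomorphism rings of subquotient bimodules -/

section Subquotients

variable {R : Type u} [Ring R] {A : Type v} [Ring A] (f : R →+* A)

/-- Left ideals of `A` that are stable under right multiplication by `R`. -/
def IsSubbimodule (I : Submodule A A) : Prop := ∀ x ∈ I, ∀ r, x * f r ∈ I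

variable {f} {I J : Submodule A A}

/-- The right action of `R` on the subquotient `I / (I ∩ J)` of the bimodule `A`. -/
def subquotientHom (hI : IsSubbimodule f I) (hJ : IsSubbimodule f J) :
    R →+* (Module.End A (I ⧸ J.submoduleOf I))ᵐᵒᵖ where
  toFun r := .op <| (J.submoduleOf I).mapQ (J.submoduleOf I)
    ((LinearMap.toSpanSingleton A A (f r)).restrict fun x hx => hI x hx r)
    fun x hx => hJ x hx r
  map_one' := MulOpposite.unop_injective <| Submodule.linearMap_qext _ <| LinearMap.ext fun x =>
    congrArg (J.submoduleOf I).mkQ (Subtype.ext (show x.1 * f 1 = x.1 by simp))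
  map_zero' := MulOpposite.unop_injective <| Submodule.linearMap_qext _ <| LinearMap.ext fun x =>
    congrArg (J.submoduleOf I).mkQ (Subtype.ext (show x.1 * f 0 = 0 by simp))
  map_mul' r s := MulOpposite.unop_injective <| Submodule.linearMap_qext _ <| LinearMap.ext fun x =>
    congrArg (J.submoduleOf I).mkQ
      (Subtype.ext (show x.1 * f (r * s) = x.1 * f r * f s by rw [map_mul, mul_assoc]))
  map_add' r s := MulOpposite.unop_injective <| Submodule.linearMap_qext _ <| LinearMap.ext fun x =>
    congrArg (J.submoduleOf I).mkQ
      (Subtype.ext (show x.1 * f (r + s) = x.1 * f r + x.1 * f s by rw [map_add, mul_add]))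

theorem subquotientHom_apply_mk (hI : IsSubbimodule f I) (hJ : IsSubbimodule f J) (r : R) (x : I) :
    (subquotientHom hI hJ r).unop (Submodule.Quotient.mk x) =
      Submodule.Quotient.mk ⟨x * f r, hI x x.2 r⟩ := rfl

theorem subquotientHom_eq_zero_iff (hI : IsSubbimodule f I) (hJ : IsSubbimodule f J) {r : R} :
    subquotientHom hI hJ r = 0 ↔ ∀ x ∈ I, x * f r ∈ J := by
  constructor
  · intro h x hx
    have := subquotientHom_apply_mk hI hJ r ⟨x, hx⟩
    rw [h] at this
    exact (Submodule.Quotient.mk_eq_zero (J.submoduleOf I)).1 this.symm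
  · intro h
    apply MulOpposite.unop_injective
    ext x
    exact (Submodule.Quotient.mk_eq_zero _).2 (h x x.2)

theorem isSemisimpleRing_subquotient [IsSemisimpleRing A] (I J : Submodule A A) :
    IsSemisimpleRing (Module.End A (I ⧸ J.submoduleOf I))ᵐᵒᵖ :=
  have := IsSemisimpleRing.moduleEnd A (I ⧸ J.submoduleOf I)
  inferInstance

theorem isUnit_subquotientHom [IsNoetherianRing A] (hI : IsSubbimodule f I)
    (hJ : IsSubbimodule f J) {r : R} (h : ∀ x ∈ I, ∃ y ∈ I, y * f r = x) :
    IsUnit (subquotientHom hI hJ r) := by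
  rw [← isUnit_unop, Module.End.isUnit_iff]
  apply IsNoetherian.bijective_of_surjective_endomorphism
  intro x
  obtain ⟨x, rfl⟩ := Submodule.Quotient.mk_surjective _ x
  obtain ⟨y, hy, hyx⟩ := h x x.2
  exact ⟨Submodule.Quotient.mk ⟨y, hy⟩, by
    rw [subquotientHom_apply_mk]; congr 1; exact Subtype.ext hyx⟩

end Subquotients

/-! ### Embedding Ore localizations -/

section Embeddings

variable {R : Type u} [Ring R]

theorem EmbedsInSemisimpleArtinian.of_injective {S : Type*} [Ring S] (g : R →+* S)
    (hg : Function.Injective g) (h : EmbedsInSemisimpleArtinian.{_, v} S) :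
    EmbedsInSemisimpleArtinian.{u, v} R :=
  let ⟨A, i, j, f, hf⟩ := h
  ⟨A, i, j, f.comp g, hf.comp hg⟩

theorem EmbedsInSimpleArtinian.of_injective {S : Type*} [Ring S] (g : R →+* S)
    (hg : Function.Injective g) (h : EmbedsInSimpleArtinian.{_, v} S) :
    EmbedsInSimpleArtinian.{u, v} R :=
  let ⟨A, i, j, k, f, hf⟩ := h
  ⟨A, i, j, k, f.comp g, hf.comp hg⟩

theorem EmbedsInSemisimpleArtinian.mulOpposite (h : EmbedsInSemisimpleArtinian.{u, v} R) :
    EmbedsInSemisimpleArtinian.{u, v} Rᵐᵒᵖ :=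
  let ⟨A, _, _, f, hf⟩ := h
  ⟨Aᵐᵒᵖ, inferInstance, inferInstance, f.op,
    fun _ _ h => MulOpposite.unop_injective (hf (MulOpposite.op_injective h))⟩

theorem EmbedsInSimpleArtinian.mulOpposite (h : EmbedsInSimpleArtinian.{u, v} R) :
    EmbedsInSimpleArtinian.{u, v} Rᵐᵒᵖ :=
  let ⟨A, _, _, _, f, hf⟩ := h
  ⟨Aᵐᵒᵖ, inferInstance, inferInstance, inferInstance, f.op,
    fun _ _ h => MulOpposite.unop_injective (hf (MulOpposite.op_injective h))⟩

/-- The left ideal is `A f(s)`, minimal over `s ∈ S`. By minimality `f s` may be replaced as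
generator by any `f (t * s)` with `t ∈ S`, and the Ore condition supplies a convenient `t`. -/
theorem exists_minimal_subbimodule_of_leftOre {A : Type v} [Ring A] [IsArtinianRing A]
    {f : R →+* A} {S : Submonoid R} (hS : IsRegularLeftOre S) :
    ∃ s ∈ S, ∃ I : Submodule A A, f s ∈ I ∧ IsSubbimodule f I ∧
      ∀ t ∈ S, ∀ x ∈ I, ∃ y ∈ I, y * f t = x := by
  obtain ⟨_, ⟨s, hs, rfl⟩, hmin⟩ := WellFounded.has_min (wellFounded_lt (α := Submodule A A))
    ((fun s => Submodule.span A {f s}) '' (S : Set R)) ⟨_, 1, S.one_mem, rfl⟩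
  have key : ∀ t ∈ S, f t ∈ Submodule.span A {f s} →
      Submodule.span A {f t} = Submodule.span A {f s} := fun t ht h =>
    (((Submodule.span_singleton_le_iff_mem _ _).2 h).eq_or_lt).resolve_right
      (hmin _ ⟨t, ht, rfl⟩)
  refine ⟨s, hs, Submodule.span A {f s}, Submodule.mem_span_singleton_self _, ?_, ?_⟩
  · intro x hx r
    obtain ⟨t, ht, r₁, h₁⟩ := hS.ore r s hs
    obtain ⟨t', ht', r₂, h₂⟩ := hS.ore s t ht
    -- `t' s = r₂ t`, so `A s = A t' s`, and `t' s r = r₂ t r = r₂ r₁ s`.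
    have hmem : f (t' * s) ∈ Submodule.span A {f s} :=
      Submodule.mem_span_singleton.2 ⟨f t', by simp⟩
    rw [← key _ (mul_mem ht' hs) hmem] at hx
    obtain ⟨a, rfl⟩ := Submodule.mem_span_singleton.1 hx
    refine Submodule.mem_span_singleton.2 ⟨a * f (r₂ * r₁), ?_⟩
    rw [smul_eq_mul, smul_eq_mul, mul_assoc, mul_assoc, ← map_mul, ← map_mul, h₂, mul_assoc,
      mul_assoc, h₁]
  · intro t ht x hx
    -- From `s' s = r' s t`, each element `a s' s` of `A s = A s' s` equals `(a r' s) t`, a multiple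
    -- of `t` by an element of `A s`.
    obtain ⟨s', hs', r', h⟩ := hS.ore s (s * t) (mul_mem hs ht)
    have hmem : f (s' * s) ∈ Submodule.span A {f s} :=
      Submodule.mem_span_singleton.2 ⟨f s', by simp⟩
    rw [← key _ (mul_mem hs' hs) hmem] at hx
    obtain ⟨a, rfl⟩ := Submodule.mem_span_singleton.1 hx
    refine ⟨a * f r' * f s, Submodule.mem_span_singleton.2 ⟨a * f r', rfl⟩, ?_⟩
    rw [smul_eq_mul, h]
    simp [mul_assoc]

/-- Elements of `S` need not become units in `A`, so the target changes to `(End_A I)ᵐᵒᵖ`.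
Faithfulness survives because `I` contains the image of a regular element `s`. -/
theorem EmbedsInSemisimpleArtinian.localization {S : Submonoid R} [OreLocalization.OreSet S]
    (hS : IsRegularLeftOre S) (h : EmbedsInSemisimpleArtinian.{u, v} R) :
    EmbedsInSemisimpleArtinian.{u, v} (OreLocalization S R) := by
  obtain ⟨A, _, _, f, hf⟩ := h
  obtain ⟨s, hs, I, hsI, hI, hdiv⟩ := exists_minimal_subbimodule_of_leftOre (f := f) hS
  have hbot : IsSubbimodule f ⊥ := fun x hx r => by simp_all
  let g := subquotientHom hI hbot
  have hg : ∀ r, g r = 0 → r = 0 := fun r hr => by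
    have := (subquotientHom_eq_zero_iff hI hbot).1 hr _ hsI
    rw [Submodule.mem_bot, ← map_mul, map_eq_zero_iff f hf] at this
    exact (hS.regular hs).1 r this
  let gS : S →* (Module.End A (I ⧸ Submodule.submoduleOf ⊥ I))ᵐᵒᵖˣ :=
    IsUnit.liftRight (g.toMonoidHom.comp S.subtype) fun t =>
      isUnit_subquotientHom hI hbot (hdiv t t.2)
  have hgS : ∀ t : S, g t = gS t := fun t => rfl
  refine ⟨_, _, isSemisimpleRing_subquotient I ⊥, OreLocalization.universalHom g gS hgS, ?_⟩
  rw [injective_iff_map_eq_zero]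
  intro x hx
  induction x with | _ r t
  rw [OreLocalization.universalHom_apply, Units.mul_right_eq_zero] at hx
  rw [hg r hx, OreLocalization.zero_oreDiv]

/-- If each component had a nonzero kernel element `a i`, primeness would link these into a nonzero
product vanishing in every component. -/
theorem IsPrimeRing.exists_injective (hR : IsPrimeRing R) {ι : Type*} [Finite ι] {B : ι → Type*}
    [∀ i, Ring (B i)] (f : R →+* Π i, B i) (hf : Function.Injective f) :
    ∃ i, Function.Injective ((Pi.evalRingHom B i).comp f) := by
  classical
  cases nonempty_fintype ι
  by_contra! hcon
  simp only [injective_iff_map_eq_zero, not_forall] at hcon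
  choose a ha ha0 using hcon
  have key : ∀ s : Finset ι, ∃ x ≠ 0, ∀ i ∈ s, f x i = 0 := by
    intro s
    induction s using Finset.induction_on with
    | empty => exact ⟨1, have := hR.1; one_ne_zero, by simp⟩
    | insert i s _ ih =>
      obtain ⟨x, hx0, hx⟩ := ih
      obtain ⟨r, hr⟩ : ∃ r, x * r * a i ≠ 0 := by
        by_contra! h
        exact (hR.2 _ _ h).elim hx0 (ha0 i)
      refine ⟨_, hr, fun j hj => ?_⟩
      rcases Finset.mem_insert.1 hj with rfl | hj
      · have : f (a j) j = 0 := ha j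
        simp [this]
      · simp [hx j hj]
  obtain ⟨x, hx0, hx⟩ := key Finset.univ
  exact hx0 ((map_eq_zero_iff f hf).1 (funext fun i => hx i (Finset.mem_univ i)))

variable (R) in
theorem numeratorRingHom_largestLeftOre_injective :
    Function.Injective (OreLocalization.numeratorRingHom (R := R) (S := largestLeftOre R)) :=
  OreLocalization.numeratorHom_inj fun _ hx =>
    ((isRegularLeftOre_largestLeftOre R).regular hx).1

theorem IsPrimeRing.embedsInSimpleArtinian_largestLeftQuotientRing (hR : IsPrimeRing R)
    (h : EmbedsInSemisimpleArtinian.{u, v} R) :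
    EmbedsInSimpleArtinian.{u, v} (LargestLeftQuotientRing R) := by
  have hS := isRegularLeftOre_largestLeftOre R
  obtain ⟨A, _, _, f, hf⟩ := h.localization hS
  obtain ⟨n, D, d, _, _, ⟨e⟩⟩ := IsSemisimpleRing.exists_ringEquiv_pi_matrix_divisionRing A
  let g : LargestLeftQuotientRing R →+* _ := e.toRingHom.comp f
  have hg : Function.Injective g := e.injective.comp hf
  -- Only `R` is known to be prime, so the factor is chosen for `R`. Injectivity passes to fractions
  -- since a fraction in the kernel has its numerator there.
  obtain ⟨i, hi⟩ := hR.exists_injective (g.comp OreLocalization.numeratorRingHom) 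
    (hg.comp (numeratorRingHom_largestLeftOre_injective R))
  refine ⟨_, inferInstance, inferInstance, inferInstance, (Pi.evalRingHom _ i).comp g, ?_⟩
  rw [injective_iff_map_eq_zero] at hi ⊢
  intro x hx
  induction x using OreLocalization.ind with | _ r t
  have ht : OreLocalization.numeratorRingHom (t : R) * (r /ₒ t) =
      OreLocalization.numeratorRingHom (S := largestLeftOre R) r :=
    OreLocalization.mul_cancel
  have : r = 0 := hi r (by
    rw [← RingHom.comp_assoc, RingHom.comp_apply, ← ht, map_mul, hx, mul_zero])
  rw [this, OreLocalization.zero_oreDiv]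

theorem IsPrimeRing.embedsInSimpleArtinian_largestRightQuotientRing (hR : IsPrimeRing R)
    (h : EmbedsInSemisimpleArtinian.{u, v} R) :
    EmbedsInSimpleArtinian.{u, v} (LargestRightQuotientRing R) :=
  (hR.mulOpposite.embedsInSimpleArtinian_largestLeftQuotientRing h.mulOpposite).mulOpposite

variable (R) in
theorem exists_injective_largestRightQuotientRing :
    ∃ g : R →+* LargestRightQuotientRing R, Function.Injective g :=
  ⟨(OreLocalization.numeratorRingHom (R := Rᵐᵒᵖ) (S := largestLeftOre Rᵐᵒᵖ)).op.comp
    (RingEquiv.opOp R).toRingHom, fun _ _ h => MulOpposite.op_injective <|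
      numeratorRingHom_largestLeftOre_injective Rᵐᵒᵖ (MulOpposite.op_injective h)⟩

end Embeddings

/-! ### Finiteness of the minimal primes -/

section MinimalPrimes

variable {R : Type u} [Ring R]

theorem isPrimeIdeal_ker_subquotientHom {A : Type v} [Ring A] {f : R →+* A} {I J : Submodule A A}
    (hI : IsSubbimodule f I) (hJ : IsSubbimodule f J) (hJI : J < I)
    (hmax : ∀ N, IsSubbimodule f N → J ≤ N → N ≤ I → N = J ∨ N = I) :
    IsPrimeIdeal (TwoSidedIdeal.ker (subquotientHom hI hJ)) := by
  have hmem : ∀ {r}, r ∈ TwoSidedIdeal.ker (subquotientHom hI hJ) ↔ ∀ x ∈ I, x * f r ∈ J := by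
    simp [TwoSidedIdeal.mem_ker, subquotientHom_eq_zero_iff]
  refine ⟨fun h => hJI.not_ge fun x hx => ?_, fun K L hKL => ?_⟩
  · have h1 : (1 : R) ∈ TwoSidedIdeal.ker (subquotientHom hI hJ) := h ▸ trivial
    simpa using hmem.1 h1 x hx
  -- `N = {x ∈ I | x L ⊆ J}` lies between `J` and `I`. If `N = I`, then `L` is in the kernel; if `N
  -- = J`, then `I K ⊆ N = J` puts `K` there.
  · let N : Submodule A A :=
      { carrier := {x | x ∈ I ∧ ∀ l ∈ L, x * f l ∈ J}
        zero_mem' := by simp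
        add_mem' := fun hx hy => ⟨I.add_mem hx.1 hy.1, fun l hl => by
          rw [add_mul]; exact J.add_mem (hx.2 l hl) (hy.2 l hl)⟩
        smul_mem' := fun a x hx => ⟨I.smul_mem a hx.1, fun l hl => by
          rw [smul_mul_assoc]; exact J.smul_mem a (hx.2 l hl)⟩ }
    have hN : IsSubbimodule f N := fun x hx r => ⟨hI x hx.1 r, fun l hl => by
      rw [mul_assoc, ← map_mul]; exact hx.2 _ (L.mul_mem_left _ _ hl)⟩
    rcases hmax N hN (fun x hx => ⟨hJI.le hx, fun l _ => hJ x hx l⟩) fun x hx => hx.1 with h | h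
    · refine .inl fun k hk => hmem.2 fun x hx => h ▸ ⟨hI x hx k, fun l hl => ?_⟩
      rw [mul_assoc, ← map_mul]
      exact hmem.1 (hKL k hk l hl) x hx
    · exact .inr fun l hl => hmem.2 fun x hx => ((h ▸ hx : x ∈ N)).2 l hl

theorem exists_finite_primes_of_subbimodule {A : Type v} [Ring A] [IsSemisimpleRing A]
    (f : R →+* A) (I : Submodule A A) (hI : IsSubbimodule f I) :
    ∃ F : Set (TwoSidedIdeal R), F.Finite ∧
      (∀ P ∈ F, IsPrimeIdeal P ∧ EmbedsInSemisimpleArtinian.{u, v} P.ringCon.Quotient) ∧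
      ∀ p, IsPrimeIdeal p → (∀ r, (∀ x ∈ I, x * f r = 0) → r ∈ p) → ∃ P ∈ F, P ≤ p := by
  induction I using WellFoundedLT.induction with | ind I ih
  by_cases hbot : I = ⊥
  · refine ⟨∅, Set.finite_empty, by simp, fun p hp h => (hp.ne_top ?_).elim⟩
    exact top_le_iff.1 fun r _ => h r (by simp [hbot])
  obtain ⟨J, ⟨hJ, hJI⟩, hmax⟩ := WellFounded.has_min (wellFounded_gt (α := Submodule A A))
    {J | IsSubbimodule f J ∧ J < I} ⟨⊥, fun x hx r => by simp_all, bot_lt_iff_ne_bot.2 hbot⟩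
  obtain ⟨F, hF, hFp, hFle⟩ := ih J hJI hJ
  have hP := isPrimeIdeal_ker_subquotientHom hI hJ hJI fun N hN hJN hNI => by
    by_contra! hne
    exact hmax N ⟨hN, hNI.lt_of_ne hne.2⟩ (hJN.lt_of_ne hne.1.symm)
  refine ⟨insert (TwoSidedIdeal.ker (subquotientHom hI hJ)) F, hF.insert _, ?_, ?_⟩
  · rintro P (rfl | hPF)
    · exact ⟨hP, _, _, isSemisimpleRing_subquotient I J, RingCon.kerLift (subquotientHom hI hJ),
        RingCon.kerLift_injective _⟩
    · exact hFp P hPF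
  · intro p hp h
    by_cases hle : TwoSidedIdeal.ker (subquotientHom hI hJ) ≤ p
    · exact ⟨_, Set.mem_insert _ _, hle⟩
    · obtain ⟨a, ha, hap⟩ := Set.not_subset.1 hle
      -- If `J b = 0`, then `I a r b ⊆ J r b ⊆ J b = 0`, so `a R b ⊆ p` with `a ∉ p` forces `b ∈ p`:
      -- the hypothesis on `p` descends from `I` to `J`.
      have ha' := (subquotientHom_eq_zero_iff hI hJ).1 ((TwoSidedIdeal.mem_ker _).1 ha)
      obtain ⟨P, hPF, hPp⟩ := hFle p hp fun b hb =>
        (hp.mem_or_mem fun r => h _ fun x hx => by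
          rw [map_mul, map_mul, ← mul_assoc, ← mul_assoc]
          exact hb _ (hJ _ (ha' x hx) r)).resolve_left hap
      exact ⟨P, Set.mem_insert_of_mem _ hPF, hPp⟩

theorem EmbedsInSemisimpleArtinian.minPrimes (h : EmbedsInSemisimpleArtinian.{u, v} R) :
    (minPrimes R).Finite ∧
      ∀ p ∈ minPrimes R, EmbedsInSemisimpleArtinian.{u, v} p.ringCon.Quotient := by
  obtain ⟨A, _, _, f, hf⟩ := h
  obtain ⟨F, hF, hFp, hFle⟩ := exists_finite_primes_of_subbimodule f ⊤ fun _ _ _ => trivial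
  have hsub : SemiprimeEmbedding.minPrimes R ⊆ F := fun p hp => by
    obtain ⟨P, hPF, hPp⟩ := hFle p hp.1 fun r hr => by
      have := hr 1 trivial
      rw [one_mul, map_eq_zero_iff f hf] at this
      exact this ▸ p.zero_mem
    rwa [hPp.antisymm (hp.2 (hFp P hPF).1 hPp)] at hPF
  exact ⟨hF.subset hsub, fun p hp => (hFp p (hsub hp)).2⟩

theorem IsSemiprimeRing.embedsInSemisimpleArtinian (hR : IsSemiprimeRing R)
    (hfin : (minPrimes R).Finite)
    (h : ∀ p ∈ minPrimes R, EmbedsInSimpleArtinian.{u, v} p.ringCon.Quotient) :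
    EmbedsInSemisimpleArtinian.{u, v} R := by
  obtain ⟨n, e, -, he⟩ := hfin.fin_param
  have hmem : ∀ i, e i ∈ minPrimes R := fun i => he ▸ Set.mem_range_self i
  choose A _ _ _ f hf using fun i => h (e i) (hmem i)
  refine ⟨Π i, A i, inferInstance, inferInstance,
    RingHom.pi fun i => (f i).comp (e i).ringCon.mk', ?_⟩
  rw [injective_iff_map_eq_zero]
  refine fun x hx => hR.eq_zero fun p hp => ?_
  rw [← he] at hp
  obtain ⟨i, rfl⟩ := hp
  have hi : f i ((e i).ringCon.mk' x) = 0 := congrFun hx i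
  exact (RingCon.eq _).1 ((map_eq_zero_iff (f i) (hf i)).1 hi)

end MinimalPrimes

end SemiprimeEmbedding

theorem theorem1p1 (R : Type u) [Ring R] (hR : SemiprimeEmbedding.IsSemiprimeRing R) :
    List.TFAE [
      SemiprimeEmbedding.EmbedsInSemisimpleArtinian.{u, v} R,
      (SemiprimeEmbedding.minPrimes R).Finite ∧
        SemiprimeEmbedding.EmbedsInSemisimpleArtinian.{u, v}
          (SemiprimeEmbedding.LargestLeftQuotientRing R),
      (SemiprimeEmbedding.minPrimes R).Finite ∧
        ∀ p ∈ SemiprimeEmbedding.minPrimes R,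
          SemiprimeEmbedding.EmbedsInSimpleArtinian.{u, v}
            (SemiprimeEmbedding.LargestLeftQuotientRing p.ringCon.Quotient),
      (SemiprimeEmbedding.minPrimes R).Finite ∧
        SemiprimeEmbedding.EmbedsInSemisimpleArtinian.{u, v}
          (SemiprimeEmbedding.LargestRightQuotientRing R),
      (SemiprimeEmbedding.minPrimes R).Finite ∧
        ∀ p ∈ SemiprimeEmbedding.minPrimes R,
          SemiprimeEmbedding.EmbedsInSimpleArtinian.{u, v}
            (SemiprimeEmbedding.LargestRightQuotientRing p.ringCon.Quotient)] := by
  tfae_have 1 → 2 := fun h => ⟨h.minPrimes.1, h.localization (SemiprimeEmbedding.isRegularLeftOre_largestLeftOre R)⟩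
  tfae_have 2 → 1 := fun h => .of_injective _ (SemiprimeEmbedding.numeratorRingHom_largestLeftOre_injective R) h.2
  tfae_have 1 → 3 := fun h => ⟨h.minPrimes.1, fun p hp =>
    hp.1.isPrimeRing_quotient.embedsInSimpleArtinian_largestLeftQuotientRing (h.minPrimes.2 p hp)⟩
  tfae_have 3 → 1 := fun h => hR.embedsInSemisimpleArtinian h.1 fun p hp =>
    .of_injective _ (SemiprimeEmbedding.numeratorRingHom_largestLeftOre_injective _) (h.2 p hp)
  tfae_have 1 → 4 := fun h => ⟨h.minPrimes.1,
    (h.mulOpposite.localization (SemiprimeEmbedding.isRegularLeftOre_largestLeftOre Rᵐᵒᵖ)).mulOpposite⟩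
  tfae_have 4 → 1 := fun h =>
    let ⟨g, hg⟩ := SemiprimeEmbedding.exists_injective_largestRightQuotientRing R
    .of_injective g hg h.2
  tfae_have 1 → 5 := fun h => ⟨h.minPrimes.1, fun p hp =>
    hp.1.isPrimeRing_quotient.embedsInSimpleArtinian_largestRightQuotientRing (h.minPrimes.2 p hp)⟩
  tfae_have 5 → 1 := fun h => hR.embedsInSemisimpleArtinian h.1 fun p hp =>
    let ⟨g, hg⟩ := SemiprimeEmbedding.exists_injective_largestRightQuotientRing p.ringCon.Quotient
    .of_injective g hg (h.2 p hp)
  tfae_finish
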